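/- Let $G=(V,E)$ be a compact topological packing graph, i.e. a simple graph whose vertex set is a compact Hausdorff space and in which every finite clique is contained in an open subset of $V$ that is a clique. Let $\alpha=\alpha(G)$ be its (finite) independence number. For $t\in\mathbb N$ let $\mathrm{sub}_t(V)$ be the set of subsets of $V$ with at most $t$ elements, topologized as the disjoint union of $\{\emptyset\}$ and the quotient of $V^t$ under $(v_1,\dots,v_t)\mapsto\{v_1,\dots,v_t\}$, and let $I_t\subseteq\mathrm{sub}_t(V)$ be the subspace of independent sets with at most $t$ elements. For a continuous symmetric kernel $K\colon I_t\times I_t\to\mathbb R$ and $S\in I_{2t}$ put $A_tK(S)=\sum_{J,J'\in I_t:\,J\cup J'=S}K(J,J')$; call $K$ positive definite if $(K(J_i,J_j))_{i,j=1}^m$ is positive semidefinite for all $m$ and all $J_1,\dots,J_m\in I_t$. A positive Radon measure is a locally finite Borel measure that is inner regular with respect to compact sets. A positive Radon measure $\lambda$ on $I_{2t}$ is feasible for $\mathrm{las}_t(G)$ if $\lambda(\{\emptyset\})=1$ and $A_t^*\lambda$ is positive definite, that is, $\langle K,A_t^*\lambda\rangle=\int A_tK\,d\lambda\ge 0$ for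 every positive definite kernel $K$ on $I_t$. If $\lambda$ is feasible for $\mathrm{las}_{\alpha}(G)$, then there is a unique Radon probability measure $\sigma$ on $I=I_{\alpha}$ ($=I_{2\alpha}$) such that $$\lambda=\int\chi_R\,d\sigma(R),\qquad \chi_R=\sum_{Q\subseteq R}\delta_Q,$$ where the integral is a weak integral of measures: $\int f\,d\lambda=\int\sum_{Q\subseteq R}f(Q)\,d\sigma(R)$ for every continuous $f\colon I_{2\alpha}\to\mathbb R$. -/

import Mathlib

open MeasureTheory

noncomputable section

namespace PackingGraph

/-- A topological packing graph: the vertex set is a Hausdorff space and each finite clique is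
contained in an open clique. -/
structure IsTopologicalPackingGraph {V : Type*} [TopologicalSpace V] (G : SimpleGraph V) :
    Prop where
  t2 : T2Space V
  exists_open_clique : ∀ s : Finset V, G.IsClique (s : Set V) →
    ∃ U : Set V, IsOpen U ∧ (s : Set V) ⊆ U ∧ G.IsClique U

/-- `sub_t(V)`: the subsets of `V` with at most `t` elements. -/
def SubsetsLE (V : Type*) (t : ℕ) : Type _ := {S : Finset V // S.card ≤ t}

/-- The empty set as an element of `sub_t(V)`. -/
def SubsetsLE.empty (V : Type*) (t : ℕ) : SubsetsLE V t := ⟨∅, Nat.zero_le t⟩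

open Classical in
/-- The map `(v₁, …, v_t) ↦ {v₁, …, v_t}`. -/
def SubsetsLE.ofTuple {V : Type*} {t : ℕ} (v : Fin t → V) : SubsetsLE V t :=
  ⟨Finset.univ.image v, Finset.card_image_le.trans (by simp)⟩

/-- The quotient topology coming from `V^t`, with the empty set added by a disjoint union. -/
instance {V : Type*} [TopologicalSpace V] {t : ℕ} : TopologicalSpace (SubsetsLE V t) :=
  TopologicalSpace.coinduced
    (Sum.elim (fun _ : Unit => SubsetsLE.empty V t) (SubsetsLE.ofTuple (V := V) (t := t)))
    inferInstance

/-- `I_t`: the independent sets of `G` with at most `t` elements. -/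
def IndepSets {V : Type*} (G : SimpleGraph V) (t : ℕ) : Type _ :=
  {S : SubsetsLE V t // G.IsIndepSet (S.1 : Set V)}

namespace IndepSets

variable {V : Type*} {G : SimpleGraph V} {t : ℕ}

/-- The underlying finite set of vertices. -/
def verts (S : IndepSets G t) : Finset V := S.1.1

/-- The empty set as an element of `I_t`. -/
def empty (G : SimpleGraph V) (t : ℕ) : IndepSets G t :=
  ⟨SubsetsLE.empty V t, by simp [SubsetsLE.empty, SimpleGraph.IsIndepSet]⟩

/-- `I_t` has the subspace topology from `sub_t(V)`. -/
instance [TopologicalSpace V] : TopologicalSpace (IndepSets G t) :=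
  TopologicalSpace.induced Subtype.val inferInstance

instance [TopologicalSpace V] : MeasurableSpace (IndepSets G t) := borel _

instance [TopologicalSpace V] : BorelSpace (IndepSets G t) := ⟨rfl⟩

theorem verts_injective : Function.Injective (verts : IndepSets G t → Finset V) :=
  fun _ _ h => Subtype.ext (Subtype.ext h)

end IndepSets

open Classical in
/-- The pairs `(J, J')` of elements of `I_t` with `J ∪ J' = S`. -/
def unionPairs {V : Type*} (G : SimpleGraph V) (t : ℕ) (S : Finset V) :
    Set (IndepSets G t × IndepSets G t) :=
  {p | p.1.verts ∪ p.2.verts = S}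

theorem finite_unionPairs {V : Type*} (G : SimpleGraph V) (t : ℕ) (S : Finset V) :
    (unionPairs G t S).Finite := by
  classical
  refine Set.Finite.of_finite_image (f := Prod.map IndepSets.verts IndepSets.verts)
    (Set.Finite.subset (S.powerset ×ˢ S.powerset).finite_toSet ?_)
    (IndepSets.verts_injective.prodMap IndepSets.verts_injective).injOn
  rintro _ ⟨p, hp, rfl⟩
  have hp' : p.1.verts ∪ p.2.verts = S := by
    simpa only [unionPairs, Set.mem_ofPred_eq] using hp
  simp only [Finset.coe_product, Set.mem_prod, Finset.mem_coe, Finset.mem_powerset, Prod.map_fst,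
    Prod.map_snd, ← hp']
  exact ⟨Finset.subset_union_left, Finset.subset_union_right⟩

/-- The operator `A_t`, `A_t K(S) = ∑_{J, J' ∈ I_t : J ∪ J' = S} K(J, J')` for `S ∈ I_{2t}`.
The sum is finite by `finite_unionPairs`. -/
def opA {V : Type*} [TopologicalSpace V] (G : SimpleGraph V) (t : ℕ)
    (K : C(IndepSets G t × IndepSets G t, ℝ)) (S : IndepSets G (2 * t)) : ℝ :=
  ∑ᶠ p ∈ unionPairs G t S.verts, K p

/-- Positive definite kernels on `X`: continuous symmetric functions on `X × X` all of whose
finite sections are positive semidefinite matrices. -/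
def IsPosDefKernel {X : Type*} [TopologicalSpace X] (K : C(X × X, ℝ)) : Prop :=
  (∀ x y : X, K (x, y) = K (y, x)) ∧
    ∀ (m : ℕ) (x : Fin m → X), (Matrix.of fun i j => K (x i, x j)).PosSemidef

/-- A (positive) Radon measure: a locally finite Borel measure such that the measure of every
Borel set is the supremum of the measures of its compact subsets. -/
def IsRadon {X : Type*} [TopologicalSpace X] [MeasurableSpace X] [BorelSpace X]
    (μ : Measure X) : Prop :=
  IsLocallyFiniteMeasure μ ∧ μ.InnerRegular

/-- The adjoint `A_t^* lam` as an element of the dual of the space of kernels: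
`⟨K, A_t^* lam⟩ = ⟨A_t K, lam⟩ = ∫ A_t K d(lam)`. -/
def adjointA {V : Type*} [TopologicalSpace V] (G : SimpleGraph V) (t : ℕ)
    (lam : Measure (IndepSets G (2 * t))) (K : C(IndepSets G t × IndepSets G t, ℝ)) : ℝ :=
  ∫ S, opA G t K S ∂lam

/-- Feasibility of `lam` for `las_t(G)`: `lam` is a positive Radon measure on `I_{2t}` with
`lam({∅}) = 1` such that `A_t^* lam` lies in the dual cone of the cone of positive definite
kernels on `I_t`. -/
structure IsFeasible {V : Type*} [TopologicalSpace V] (G : SimpleGraph V) (t : ℕ)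
    (lam : Measure (IndepSets G (2 * t))) : Prop where
  isRadon : IsRadon lam
  normalized : lam {IndepSets.empty G (2 * t)} = 1
  posDef : ∀ K : C(IndepSets G t × IndepSets G t, ℝ), IsPosDefKernel K → 0 ≤ adjointA G t lam K

/-- The measure `χ_R = ∑_{Q ⊆ R} δ_Q` on `I_s`. -/
def chi {V : Type*} [TopologicalSpace V] (G : SimpleGraph V) (s : ℕ) (R : Finset V) :
    Measure (IndepSets G s) :=
  Measure.sum fun Q : {Q : IndepSets G s // Q.verts ⊆ R} => Measure.dirac Q.1

/-- `ρ = ∫ ν_x dτ(x)` as a weak integral of measures: `ρ(f) = ∫ ν_x(f) dτ(x)` for every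
continuous `f`. -/
def IsWeakIntegral {X Y : Type*} [MeasurableSpace X] [TopologicalSpace Y] [MeasurableSpace Y]
    (ρ : Measure Y) (ν : X → Measure Y) (τ : Measure X) : Prop :=
  ∀ f : C(Y, ℝ), Integrable (fun x => ∫ y, f y ∂(ν x)) τ ∧
    ∫ y, f y ∂ρ = ∫ x, (∫ y, f y ∂(ν x)) ∂τ

end PackingGraph

end

/-! Write α for the independence number. Every independent set has at most α elements, so `I_α` and
`I_{2α}` have the same members. The zeta transform `Zf(R) = ∑_{Q ⊆ R} f(Q)` and the Möbius transform
`M` are therefore mutually inverse maps between spaces of continuous functions. Since `∫ f dχ_R =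
Zf(R)`, the required identity reads `λ(f) = σ(Zf)`, that is, `σ(g) = λ(Mg)`. This determines σ, and
by Riesz–Markov–Kakutani existence reduces to positivity of `g ↦ λ(Mg)`.

For positivity, let `g = k²` and `h = Mk`. The zeta transform turns union convolution into pointwise
multiplication, so `A_α(h ⊗ h) = M(k²)` (`opA_mul_powersetTransform`). As `h ⊗ h` is positive
definite, feasibility gives `λ(Mg) ≥ 0`. The total mass is `λ(M1) = λ({∅}) = 1`.

The packing condition enters through the topology: it makes `I_t` compact, bounds independent sets,
and makes the transforms preserve continuity (`continuous_sum_powerset`). -/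

/-! ### Möbius inversion on finite sets -/

section MoebiusInversion

variable {V : Type*} [DecidableEq V]

/-- Adding `T` identifies the subsets of `S \ T` with the interval, and an alternating sum over a
powerset vanishes unless the set is empty. -/
theorem Finset.sum_Icc_neg_one_pow_card_sdiff {T S : Finset V} (h : T ⊆ S) :
    ∑ Q ∈ Finset.Icc T S, (-1 : ℝ) ^ (Q \ T).card = if T = S then 1 else 0 := by
  rw [Finset.Icc_eq_image_powerset h, Finset.sum_image]
  · have h1 : ∀ P ∈ (S \ T).powerset, (-1 : ℝ) ^ ((T ∪ P) \ T).card = (-1) ^ P.card := by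
      intro P hP
      rw [Finset.mem_powerset] at hP
      have : (T ∪ P) \ T = P := by
        ext x
        have := @hP x
        simp only [Finset.mem_sdiff, Finset.mem_union] at *
        tauto
      rw [this]
    rw [Finset.sum_congr rfl h1]
    have h2 := congrArg (Int.cast : ℤ → ℝ)
      (Finset.sum_powerset_neg_one_pow_card (x := S \ T))
    push_cast at h2
    rw [h2]
    congr 1
    rw [Finset.sdiff_eq_empty_iff_subset]
    exact propext ⟨fun h' => h.antisymm h', fun h' => h' ▸ subset_rfl⟩
  · intro P hP P' hP' hPP'
    simp only [Finset.coe_powerset, Set.mem_preimage, Set.mem_powerset_iff, Finset.coe_subset]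
      at hP hP'
    ext x
    have h1 := @hP x
    have h2 := @hP' x
    have h3 := Finset.ext_iff.1 hPP' x
    simp only [Finset.mem_sdiff, Finset.mem_union] at *
    tauto

theorem Finset.sum_powerset_sum_powerset_neg_one_pow (a : Finset V → ℝ) (S : Finset V) :
    ∑ Q ∈ S.powerset, ∑ T ∈ Q.powerset, (-1) ^ (Q \ T).card * a T = a S := by
  rw [Finset.sum_comm' (t' := S.powerset) (s' := fun T => Finset.Icc T S)]
  · rw [Finset.sum_congr rfl (g := fun T => if T = S then a T else 0)]
    · simp
    · intro T hT
      rw [← Finset.sum_mul, Finset.sum_Icc_neg_one_pow_card_sdiff (Finset.mem_powerset.1 hT)]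
      split_ifs <;> simp
  · intro Q T
    simp only [Finset.mem_powerset, Finset.mem_Icc]
    exact ⟨fun h => ⟨⟨h.2, h.1⟩, h.2.trans h.1⟩, fun h => ⟨h.1.2, h.1.1⟩⟩

theorem Finset.sum_powerset_neg_one_pow_sum_powerset (a : Finset V → ℝ) (S : Finset V) :
    ∑ Q ∈ S.powerset, (-1) ^ (S \ Q).card * ∑ T ∈ Q.powerset, a T = a S := by
  simp_rw [Finset.mul_sum]
  rw [Finset.sum_comm' (t' := S.powerset) (s' := fun T => Finset.Icc T S)]
  · rw [Finset.sum_congr rfl (g := fun T => if T = S then a T else 0)]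
    · simp
    · intro T hT
      have h1 : ∀ Q ∈ Finset.Icc T S, (-1 : ℝ) ^ (S \ Q).card * a T
          = (-1) ^ (Q \ T).card * ((-1) ^ (S \ T).card * a T) := by
        intro Q hQ
        rw [Finset.mem_Icc] at hQ
        have h2 : (S \ T).card = (S \ Q).card + (Q \ T).card := by
          rw [Finset.card_sdiff_of_subset (hQ.1.trans hQ.2), Finset.card_sdiff_of_subset hQ.1,
            Finset.card_sdiff_of_subset hQ.2]
          have := Finset.card_le_card hQ.1
          have := Finset.card_le_card hQ.2
          omega
        have h3 : (-1 : ℝ) ^ (Q \ T).card * (-1) ^ (Q \ T).card = 1 := by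
          rw [← mul_pow]; simp
        rw [h2, pow_add]
        linear_combination (-(-1 : ℝ) ^ (S \ Q).card * a T) * h3
      rw [Finset.sum_congr rfl h1, ← Finset.sum_mul,
        Finset.sum_Icc_neg_one_pow_card_sdiff (Finset.mem_powerset.1 hT)]
      split_ifs with h
      · simp [h]
      · simp
  · intro Q T
    simp only [Finset.mem_powerset, Finset.mem_Icc]
    exact ⟨fun h => ⟨⟨h.2, h.1⟩, h.2.trans h.1⟩, fun h => ⟨h.1.2, h.1.1⟩⟩

/-- The union convolution square of `h` is the Möbius transform of the square of its zeta
transform. -/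
theorem Finset.sum_union_eq_mul (h : Finset V → ℝ) (S : Finset V) :
    ∑ p ∈ (S.powerset ×ˢ S.powerset).filter (fun p => p.1 ∪ p.2 = S), h p.1 * h p.2
      = ∑ Q ∈ S.powerset, (-1) ^ (S \ Q).card * (∑ J ∈ Q.powerset, h J) ^ 2 := by
  -- By Möbius inversion it suffices to compare zeta transforms: the pairs with union inside `Q` are
  -- exactly the pairs of subsets of `Q`.
  rw [← Finset.sum_powerset_neg_one_pow_sum_powerset
    (fun S => ∑ p ∈ (S.powerset ×ˢ S.powerset).filter (fun p => p.1 ∪ p.2 = S), h p.1 * h p.2) S]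
  refine Finset.sum_congr rfl fun Q _ => ?_
  congr 1
  rw [sq, Finset.sum_mul_sum, ← Finset.sum_product',
    ← Finset.sum_fiberwise_of_maps_to (s := Q.powerset ×ˢ Q.powerset) (t := Q.powerset)
      (g := fun p => p.1 ∪ p.2)]
  · refine Finset.sum_congr rfl fun T hT => Finset.sum_congr ?_ fun _ _ => rfl
    rw [Finset.mem_powerset] at hT
    ext ⟨J, J'⟩
    simp only [Finset.mem_filter, Finset.mem_product, Finset.mem_powerset]
    constructor
    · rintro ⟨⟨h1, h2⟩, h3⟩
      exact ⟨⟨h1.trans hT, h2.trans hT⟩, h3⟩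
    · rintro ⟨-, rfl⟩
      exact ⟨⟨Finset.subset_union_left, Finset.subset_union_right⟩, rfl⟩
  · rintro ⟨J, J'⟩ hp
    simp only [Finset.mem_product, Finset.mem_powerset] at hp ⊢
    exact Finset.union_subset hp.1 hp.2

end MoebiusInversion

/-! ### Measures and positive functionals on a compact space -/

section Riesz

variable {X : Type*} [TopologicalSpace X] [CompactSpace X] [T2Space X] [MeasurableSpace X]
  [BorelSpace X]

/-- The Riesz–Markov–Kakutani theorem for positive functionals on `C(X, ℝ)`, `X` compact. -/
theorem exists_regular_integral_eq (Λ : C(X, ℝ) →ₗ[ℝ] ℝ) (hΛ : ∀ f : C(X, ℝ), 0 ≤ f → 0 ≤ Λ f) :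
    ∃ μ : Measure X, μ.Regular ∧ IsFiniteMeasure μ ∧ ∀ f : C(X, ℝ), ∫ x, f x ∂μ = Λ f := by
  let L : CompactlySupportedContinuousMap X ℝ →ₚ[ℝ] ℝ :=
  { toFun g := Λ g.toContinuousMap
    map_add' g g' := Λ.map_add _ _
    map_smul' c g := Λ.map_smul _ _
    monotone' g g' hgg' := by
      have h := hΛ (g'.toContinuousMap - g.toContinuousMap)
        (fun x => sub_nonneg.2 (hgg' x))
      rw [map_sub] at h
      exact sub_nonneg.1 h }
  refine ⟨RealRMK.rieszMeasure L, inferInstance, inferInstance, fun f => ?_⟩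
  exact RealRMK.integral_rieszMeasure L ⟨f, HasCompactSupport.of_compactSpace _⟩

theorem ext_of_integral_eq_of_innerRegular {μ ν : Measure X} [IsFiniteMeasure μ]
    [IsFiniteMeasure ν] [μ.InnerRegular] [ν.InnerRegular]
    (h : ∀ f : C(X, ℝ), ∫ x, f x ∂μ = ∫ x, f x ∂ν) : μ = ν :=
  Measure.ext_of_integral_eq_on_compactlySupported fun f => h f.toContinuousMap

omit [T2Space X] in
theorem ContinuousMap.integrable_of_isFiniteMeasure {μ : Measure X} [IsFiniteMeasure μ]
    (f : C(X, ℝ)) : Integrable f μ :=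
  f.continuous.integrable_of_hasCompactSupport (HasCompactSupport.of_compactSpace _)

end Riesz

noncomputable section

namespace PackingGraph

open Filter Topology

variable {V : Type*} [TopologicalSpace V]

/-! ### Topology of `sub_t(V)` and `I_t` -/

section Topology

theorem SubsetsLE.isOpen_iff {t : ℕ} {s : Set (SubsetsLE V t)} :
    IsOpen s ↔ IsOpen ((SubsetsLE.ofTuple (V := V) (t := t)) ⁻¹' s) := by
  rw [isOpen_coinduced, isOpen_sum_iff]
  refine ⟨fun h => h.2, fun h => ⟨isOpen_discrete _, h⟩⟩

theorem SubsetsLE.continuous_ofTuple {t : ℕ} :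
    Continuous (SubsetsLE.ofTuple (V := V) (t := t)) :=
  continuous_def.2 fun _ hs => SubsetsLE.isOpen_iff.1 hs

omit [TopologicalSpace V] in
theorem SubsetsLE.mem_ofTuple {t : ℕ} {v : Fin t → V} {x : V} :
    x ∈ (SubsetsLE.ofTuple v).1 ↔ ∃ i, v i = x := by
  simp [SubsetsLE.ofTuple]

omit [TopologicalSpace V] in
theorem SubsetsLE.exists_ofTuple_eq {t : ℕ} (S : SubsetsLE V t) (hS : S.1.Nonempty) :
    ∃ v : Fin t → V, SubsetsLE.ofTuple v = S := by
  classical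
  obtain ⟨x, hx⟩ := hS
  let e := S.1.equivFin
  -- List the elements of `S` and pad with `x` up to length `t`.
  refine ⟨fun i => if h : i.1 < S.1.card then (e.symm ⟨i.1, h⟩).1 else x, Subtype.ext ?_⟩
  ext y
  rw [SubsetsLE.mem_ofTuple]
  constructor
  · rintro ⟨i, rfl⟩
    split_ifs
    · exact Subtype.prop _
    · exact hx
  · intro hy
    refine ⟨⟨(e ⟨y, hy⟩).1, (e ⟨y, hy⟩).2.trans_le S.2⟩, ?_⟩
    simp

instance [CompactSpace V] {t : ℕ} : CompactSpace (SubsetsLE V t) := by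
  have hc : Continuous
      (Sum.elim (fun _ : Unit => SubsetsLE.empty V t) (SubsetsLE.ofTuple (V := V) (t := t))) :=
    continuous_coinduced_rng
  refine Function.Surjective.compactSpace hc (fun S => ?_)
  rcases S.1.eq_empty_or_nonempty with h | h
  · exact ⟨Sum.inl (), Subtype.ext h.symm⟩
  · obtain ⟨v, hv⟩ := S.exists_ofTuple_eq h
    exact ⟨Sum.inr v, hv⟩

theorem SubsetsLE.isOpen_subset {t : ℕ} {U : Set V} (hU : IsOpen U) :
    IsOpen {S : SubsetsLE V t | (S.1 : Set V) ⊆ U} := by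
  rw [SubsetsLE.isOpen_iff]
  have : SubsetsLE.ofTuple ⁻¹' {S : SubsetsLE V t | (S.1 : Set V) ⊆ U}
      = ⋂ i, {v : Fin t → V | v i ∈ U} := by
    ext v
    simp [SubsetsLE.ofTuple, Set.subset_def]
  rw [this]
  exact isOpen_iInter_of_finite fun i => hU.preimage (continuous_apply i)

theorem SubsetsLE.isOpen_meets {t : ℕ} {U : Set V} (hU : IsOpen U) :
    IsOpen {S : SubsetsLE V t | ∃ x ∈ S.1, x ∈ U} := by
  rw [SubsetsLE.isOpen_iff]
  have : SubsetsLE.ofTuple ⁻¹' {S : SubsetsLE V t | ∃ x ∈ S.1, x ∈ U}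
      = ⋃ i, {v : Fin t → V | v i ∈ U} := by
    ext v
    simp [SubsetsLE.ofTuple]
  rw [this]
  exact isOpen_iUnion fun i => hU.preimage (continuous_apply i)

instance [T2Space V] {t : ℕ} : T2Space (SubsetsLE V t) := by
  have key : ∀ S T : SubsetsLE V t, ∀ x ∈ S.1, x ∉ T.1 →
      ∃ u v : Set (SubsetsLE V t), IsOpen u ∧ IsOpen v ∧ S ∈ u ∧ T ∈ v ∧ Disjoint u v := by
    intro S T x hx hxT
    obtain ⟨U, W, hU, hW, hxU, hTW, hUW⟩ := SeparatedNhds.of_isCompact_isCompact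
      (isCompact_singleton (x := x)) T.1.finite_toSet.isCompact
      (Set.disjoint_singleton_left.2 hxT)
    refine ⟨_, _, SubsetsLE.isOpen_meets hU, SubsetsLE.isOpen_subset hW,
      ⟨x, hx, hxU rfl⟩, hTW, ?_⟩
    rw [Set.disjoint_left]
    rintro R ⟨y, hy, hyU⟩ hR
    exact Set.disjoint_left.1 hUW hyU (hR hy)
  refine ⟨fun S T hST => ?_⟩
  by_cases h : ∃ x ∈ S.1, x ∉ T.1
  · obtain ⟨x, hx, hxT⟩ := h
    exact key S T x hx hxT
  · push Not at h
    have : ∃ x ∈ T.1, x ∉ S.1 := by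
      by_contra! h'
      exact hST (Subtype.ext (Finset.Subset.antisymm h h'))
    obtain ⟨x, hx, hxS⟩ := this
    obtain ⟨u, v, hu, hv, h1, h2, h3⟩ := key T S x hx hxS
    exact ⟨v, u, hv, hu, h2, h1, h3.symm⟩

variable {G : SimpleGraph V} {t : ℕ}

theorem IndepSets.isEmbedding_val :
    IsEmbedding (Subtype.val : IndepSets G t → SubsetsLE V t) :=
  IsEmbedding.subtypeVal

instance [T2Space V] : T2Space (IndepSets G t) := IndepSets.isEmbedding_val.t2Space

/-- Containing an edge is an open condition: both ends lie in an open clique, and any set meeting it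
inside disjoint neighbourhoods of the two ends contains an edge again. -/
theorem IsTopologicalPackingGraph.isClosed_setOf_isIndepSet (hG : IsTopologicalPackingGraph G) :
    IsClosed {S : SubsetsLE V t | G.IsIndepSet (S.1 : Set V)} := by
  have := hG.t2
  rw [← isOpen_compl_iff, isOpen_iff_mem_nhds]
  intro S hS
  have : ∃ x ∈ S.1, ∃ y ∈ S.1, G.Adj x y := by
    by_contra! h
    exact hS fun x hx y hy _ => h x hx y hy
  obtain ⟨x, hx, y, hy, hxy⟩ := this
  classical
  obtain ⟨U, hU, hxyU, hUc⟩ := hG.exists_open_clique {x, y} (by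
    simp [SimpleGraph.isClique_iff, hxy])
  obtain ⟨A, B, hA, hB, hxA, hyB, hAB⟩ := t2_separation hxy.ne
  have h1 : {R : SubsetsLE V t | ∃ z ∈ R.1, z ∈ U ∩ A} ∈ 𝓝 S :=
    (SubsetsLE.isOpen_meets (hU.inter hA)).mem_nhds ⟨x, hx, hxyU (by simp), hxA⟩
  have h2 : {R : SubsetsLE V t | ∃ z ∈ R.1, z ∈ U ∩ B} ∈ 𝓝 S :=
    (SubsetsLE.isOpen_meets (hU.inter hB)).mem_nhds ⟨y, hy, hxyU (by simp), hyB⟩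
  filter_upwards [h1, h2]
  rintro R ⟨z, hz, hzU, hzA⟩ ⟨w, hw, hwU, hwB⟩ hR
  have hzw : z ≠ w := fun h => Set.disjoint_left.1 hAB hzA (h ▸ hwB)
  exact hR hz hw hzw (hUc hzU hwU hzw)

theorem IsTopologicalPackingGraph.compactSpace_indepSets [CompactSpace V]
    (hG : IsTopologicalPackingGraph G) : CompactSpace (IndepSets G t) :=
  isCompact_iff_compactSpace.1 (hG.isClosed_setOf_isIndepSet (t := t)).isCompact

theorem IndepSets.isOpen_subset {U : Set V} (hU : IsOpen U) :
    IsOpen {S : IndepSets G t | (S.verts : Set V) ⊆ U} :=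
  (SubsetsLE.isOpen_subset hU).preimage IndepSets.isEmbedding_val.continuous

theorem IndepSets.isOpen_meets {U : Set V} (hU : IsOpen U) :
    IsOpen {S : IndepSets G t | ∃ x ∈ S.verts, x ∈ U} :=
  (SubsetsLE.isOpen_meets hU).preimage IndepSets.isEmbedding_val.continuous

omit [TopologicalSpace V] in
theorem IndepSets.isIndepSet (S : IndepSets G t) : G.IsIndepSet (S.verts : Set V) := S.2

/-- Finitely many open cliques cover `V`, and an independent set has at most one vertex in each.
This uniform bound is what makes the supremum `indepNum` meaningful. -/
theorem IsTopologicalPackingGraph.card_le_indepNum [CompactSpace V]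
    (hG : IsTopologicalPackingGraph G) {S : Finset V} (hS : G.IsIndepSet (S : Set V)) :
    S.card ≤ G.indepNum := by
  have h : ∀ x : V, ∃ U : Set V, IsOpen U ∧ x ∈ U ∧ G.IsClique U := by
    intro x
    obtain ⟨U, hU, hxU, hUc⟩ := hG.exists_open_clique {x} (by simp)
    exact ⟨U, hU, hxU (by simp), hUc⟩
  choose U hU hxU hUc using h
  obtain ⟨F, hF⟩ := isCompact_univ.elim_finite_subcover U hU
    (fun x _ => Set.mem_iUnion.2 ⟨x, hxU x⟩)
  have hbound : ∀ S : Finset V, G.IsIndepSet (S : Set V) → S.card ≤ F.card := by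
    intro S hS
    have h : ∀ x : V, ∃ y ∈ F, x ∈ U y := by
      intro x
      simpa using hF (Set.mem_univ x)
    choose c hcF hc using h
    refine Finset.card_le_card_of_injOn c (fun x _ => hcF x) ?_
    intro x hx y hy hxy
    by_contra hne
    exact hS hx hy hne (hUc (c x) (hc x) (hxy ▸ hc y) hne)
  refine le_csSup ⟨F.card, ?_⟩ ⟨S, hS, rfl⟩
  rintro n ⟨S, hS, rfl⟩
  exact hbound S hS

end Topology

/-! ### Continuity of sums over subsets -/

section Transform

variable {G : SimpleGraph V} {s t : ℕ}

open Classical in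
/-- Extension by zero of a function on `I_s` to all finite sets. -/
def IndepSets.extend (f : IndepSets G s → ℝ) (Q : Finset V) : ℝ :=
  if h : Q.card ≤ s ∧ G.IsIndepSet (Q : Set V) then f ⟨⟨Q, h.1⟩, h.2⟩ else 0

omit [TopologicalSpace V] in
@[simp]
theorem IndepSets.extend_verts (f : IndepSets G s → ℝ) (S : IndepSets G s) :
    IndepSets.extend f S.verts = f S :=
  dif_pos (⟨S.1.2, S.2⟩ : S.verts.card ≤ s ∧ _)

open Classical in
/-- If the points of `A` are moved continuously, so is the set `A`. -/
theorem IndepSets.tendsto_of_verts_eq_image {X : Type*} {l : Filter X} {ρ : X → V → V}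
    (A : IndepSets G s) (hρ : ∀ r ∈ A.verts, Tendsto (fun x => ρ x r) l (𝓝 r))
    {g : X → IndepSets G s} (hg : ∀ᶠ x in l, (g x).verts = A.verts.image (ρ x)) :
    Tendsto g l (𝓝 A) := by
  refine IndepSets.isEmbedding_val.tendsto_nhds_iff.2 ?_
  rcases A.verts.eq_empty_or_nonempty with h | h
  · refine tendsto_const_nhds.congr' ?_
    filter_upwards [hg] with x hx
    refine Subtype.ext ?_
    rw [h, Finset.image_empty] at hx
    exact h.trans hx.symm
  · obtain ⟨v, hv⟩ := A.1.exists_ofTuple_eq h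
    have hvA : ∀ i, v i ∈ A.verts := fun i => by
      change v i ∈ A.1.1
      rw [← hv, SubsetsLE.mem_ofTuple]
      exact ⟨i, rfl⟩
    have h1 : Tendsto (fun x => SubsetsLE.ofTuple (fun i => ρ x (v i))) l
        (𝓝 (SubsetsLE.ofTuple v)) :=
      (SubsetsLE.continuous_ofTuple.tendsto v).comp
        (tendsto_pi_nhds.2 fun i => hρ _ (hvA i))
    rw [hv] at h1
    refine h1.congr' ?_
    filter_upwards [hg] with x hx
    refine Subtype.ext (Eq.trans ?_ hx.symm)
    ext y
    have : A.verts = (SubsetsLE.ofTuple v).1 := by rw [hv]; rfl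
    rw [SubsetsLE.mem_ofTuple, this]
    simp [SubsetsLE.mem_ofTuple]

open Classical in
/-- Near an independent set `R` the independent sets are the images of `R` under maps
that depend continuously on the set. -/
theorem IsTopologicalPackingGraph.exists_local_parametrization
    (hG : IsTopologicalPackingGraph G) (R : IndepSets G t) :
    ∃ ρ : IndepSets G t → V → V,
      (∀ r ∈ R.verts, Tendsto (fun S => ρ S r) (𝓝 R) (𝓝 r)) ∧
      (∀ r ∈ R.verts, ρ R r = r) ∧
      ∀ᶠ S in 𝓝 R, Set.InjOn (ρ S) R.verts ∧ R.verts.image (ρ S) = S.verts := by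
  have := hG.t2
  obtain ⟨W, hW, hWd⟩ := R.verts.finite_toSet.t2_separation
  have h : ∀ x : V, ∃ U : Set V, IsOpen U ∧ x ∈ U ∧ G.IsClique U := by
    intro x
    obtain ⟨U, hU, hxU, hUc⟩ := hG.exists_open_clique {x} (by simp)
    exact ⟨U, hU, hxU (by simp), hUc⟩
  choose C hC hxC hCc using h
  -- The clique `C x` contains at most one point of any independent set, and the `W r` separate the
  -- points of `R`. Hence a set near `R` has exactly one point in each `U r`.
  let U : V → Set V := fun x => C x ∩ W x
  have hU : ∀ x, IsOpen (U x) := fun x => (hC x).inter (hW x).2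
  have hxU : ∀ x, x ∈ U x := fun x => ⟨hxC x, (hW x).1⟩
  have huniq : ∀ (S : IndepSets G t) (r x y : V), x ∈ S.verts → y ∈ S.verts → x ∈ U r →
      y ∈ U r → x = y := by
    intro S r x y hx hy hxr hyr
    by_contra hne
    exact S.isIndepSet hx hy hne (hCc r hxr.1 hyr.1 hne)
  -- The point of `S` in `U r`; the default value plays no role for `S` near `R`.
  let ρ : IndepSets G t → V → V := fun S r =>
    if h : ∃ x ∈ S.verts, x ∈ U r then h.choose else r
  have hρ : ∀ (S : IndepSets G t) (r : V), (∃ x ∈ S.verts, x ∈ U r) →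
      ρ S r ∈ S.verts ∧ ρ S r ∈ U r := by
    intro S r h
    simp only [ρ, dif_pos h]
    exact h.choose_spec
  have hρeq : ∀ (S : IndepSets G t) (r x : V), x ∈ S.verts → x ∈ U r → ρ S r = x := by
    intro S r x hx hxr
    have h := hρ S r ⟨x, hx, hxr⟩
    exact huniq S r _ _ h.1 hx h.2 hxr
  refine ⟨ρ, fun r hr => ?_, fun r hr => hρeq R r r hr (hxU r), ?_⟩
  · rw [tendsto_nhds]
    intro N hN hrN
    have h1 : {S : IndepSets G t | ∃ x ∈ S.verts, x ∈ U r ∩ N} ∈ 𝓝 R :=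
      (IndepSets.isOpen_meets ((hU r).inter hN)).mem_nhds ⟨r, hr, hxU r, hrN⟩
    filter_upwards [h1]
    rintro S ⟨x, hx, hxU, hxN⟩
    rw [Set.mem_preimage, hρeq S r x hx hxU]
    exact hxN
  · have h1 : {S : IndepSets G t | (S.verts : Set V) ⊆ ⋃ r ∈ R.verts, U r} ∈ 𝓝 R :=
      (IndepSets.isOpen_subset (isOpen_biUnion fun r _ => hU r)).mem_nhds
        fun r hr => Set.mem_biUnion hr (hxU r)
    have h2 : ∀ᶠ S in 𝓝 R, ∀ r ∈ R.verts, ∃ x ∈ S.verts, x ∈ U r := by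
      rw [Filter.eventually_all_finset]
      intro r hr
      exact (IndepSets.isOpen_meets (hU r)).mem_nhds ⟨r, hr, hxU r⟩
    filter_upwards [h1, h2] with S hS1 hS2
    refine ⟨fun r hr r' hr' h => ?_, ?_⟩
    · by_contra hne
      have e1 := (hρ S r (hS2 r hr)).2
      have e2 := (hρ S r' (hS2 r' hr')).2
      exact Set.disjoint_left.1 (hWd hr hr' hne) e1.2 (h ▸ e2.2)
    · ext x
      rw [Finset.mem_image]
      constructor
      · rintro ⟨r, hr, rfl⟩
        exact (hρ S r (hS2 r hr)).1
      · intro hx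
        obtain ⟨r, hr, hxr⟩ := Set.mem_iUnion₂.1 (hS1 hx)
        exact ⟨r, hr, hρeq S r x hx hxr⟩

-- Near `R` the subsets of `S` are the images of the subsets `A` of `R`, with complements of equal
-- size. The sum thus has a locally fixed index set and terms continuous at `R`.
open Classical in
theorem IsTopologicalPackingGraph.continuous_sum_powerset
    (hG : IsTopologicalPackingGraph G) (hs : ∀ S : Finset V, G.IsIndepSet (S : Set V) → S.card ≤ s)
    (w : ℕ → ℝ) (f : C(IndepSets G s, ℝ)) :
    Continuous fun R : IndepSets G t =>
      ∑ Q ∈ R.verts.powerset, w (R.verts \ Q).card * IndepSets.extend f Q := by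
  rw [continuous_iff_continuousAt]
  intro R
  obtain ⟨ρ, hρ, hρR, hev⟩ := hG.exists_local_parametrization R
  have hsum : ∀ᶠ S in 𝓝 R,
      ∑ Q ∈ S.verts.powerset, w (S.verts \ Q).card * IndepSets.extend f Q
        = ∑ A ∈ R.verts.powerset,
          w (R.verts \ A).card * IndepSets.extend f (A.image (ρ S)) := by
    filter_upwards [hev] with S hS
    symm
    refine Finset.sum_bij (fun A _ => A.image (ρ S)) ?_ ?_ ?_ ?_
    · intro A hA
      rw [Finset.mem_powerset] at hA ⊢
      rw [← hS.2]
      exact Finset.image_subset_image hA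
    · intro A hA B hB hAB
      rw [Finset.mem_powerset] at hA hB
      have := congrArg (fun F : Finset V => (F : Set V)) hAB
      simp only [Finset.coe_image] at this
      exact Finset.coe_injective
        ((hS.1.image_eq_image_iff (Finset.coe_subset.2 hA) (Finset.coe_subset.2 hB)).1 this)
    · intro Q hQ
      rw [Finset.mem_powerset, ← hS.2, Finset.subset_image_iff] at hQ
      obtain ⟨A, hA, rfl⟩ := hQ
      exact ⟨A, Finset.mem_powerset.2 hA, rfl⟩
    · intro A hA
      rw [Finset.mem_powerset] at hA
      congr 2
      rw [← hS.2, Finset.card_sdiff_of_subset hA,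
        Finset.card_sdiff_of_subset (Finset.image_subset_image hA),
        Finset.card_image_of_injOn hS.1,
        Finset.card_image_of_injOn (hS.1.mono (Finset.coe_subset.2 hA))]
  rw [ContinuousAt, hsum.self_of_nhds]
  refine Tendsto.congr' (hsum.mono fun _ h => h.symm) ?_
  refine tendsto_finsetSum _ fun A hA => Tendsto.const_mul _ ?_
  rw [Finset.mem_powerset] at hA
  have hAi : G.IsIndepSet (A : Set V) := R.isIndepSet.mono (Finset.coe_subset.2 hA)
  let A' : IndepSets G s := ⟨⟨A, hs A hAi⟩, hAi⟩
  have hAR : A.image (ρ R) = A := by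
    rw [Finset.image_congr (g := id) fun r hr => hρR r (hA hr), Finset.image_id]
  rw [hAR, show IndepSets.extend f A = f A' from IndepSets.extend_verts f A']
  let g : IndepSets G t → IndepSets G s := fun S =>
    if h : G.IsIndepSet (A.image (ρ S) : Set V) then ⟨⟨A.image (ρ S), hs _ h⟩, h⟩ else A'
  have hg : ∀ᶠ S in 𝓝 R, (g S).verts = A.image (ρ S) := by
    filter_upwards [hev] with S hS
    have h : G.IsIndepSet (A.image (ρ S) : Set V) := by
      refine S.isIndepSet.mono ?_
      rw [← hS.2]
      exact_mod_cast Finset.image_subset_image hA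
    have hgS : g S = ⟨⟨A.image (ρ S), hs _ h⟩, h⟩ := dif_pos h
    rw [hgS]
    rfl
  have hgt : Tendsto g (𝓝 R) (𝓝 A') :=
    IndepSets.tendsto_of_verts_eq_image A' (fun r hr => hρ r (hA hr)) hg
  refine ((f.continuous.tendsto A').comp hgt).congr' ?_
  filter_upwards [hg] with S hS
  rw [← hS, IndepSets.extend_verts]
  rfl

end Transform

/-! ### Zeta and Möbius transforms of continuous functions; positivity -/

variable {G : SimpleGraph V} {s t : ℕ}

omit [TopologicalSpace V] in
theorem IndepSets.extend_add (f g : IndepSets G s → ℝ) (Q : Finset V) :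
    IndepSets.extend (f + g) Q = IndepSets.extend f Q + IndepSets.extend g Q := by
  unfold IndepSets.extend
  split_ifs
  · rfl
  · exact (add_zero 0).symm

omit [TopologicalSpace V] in
theorem IndepSets.extend_smul (c : ℝ) (f : IndepSets G s → ℝ) (Q : Finset V) :
    IndepSets.extend (c • f) Q = c * IndepSets.extend f Q := by
  unfold IndepSets.extend
  split_ifs
  · rfl
  · exact (mul_zero c).symm

open Classical in
/-- The operator `f ↦ (R ↦ ∑_{Q ⊆ R} w(|R \ Q|) f(Q))` from `C(I_s)` to `C(I_t)`, where `s` is at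
least the independence number. It is the zeta transform for `w = 1` and the Möbius transform for
`w(n) = (-1)^n`. -/
def powersetTransform (hG : IsTopologicalPackingGraph G)
    (hs : ∀ S : Finset V, G.IsIndepSet (S : Set V) → S.card ≤ s) (t : ℕ) (w : ℕ → ℝ) :
    C(IndepSets G s, ℝ) →ₗ[ℝ] C(IndepSets G t, ℝ) where
  toFun f := ⟨fun R => ∑ Q ∈ R.verts.powerset, w (R.verts \ Q).card * IndepSets.extend f Q,
    hG.continuous_sum_powerset hs w f⟩
  map_add' f g := by
    ext R
    simp only [ContinuousMap.coe_mk, ContinuousMap.add_apply, ← Finset.sum_add_distrib]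
    refine Finset.sum_congr rfl fun Q _ => ?_
    rw [ContinuousMap.coe_add, IndepSets.extend_add, mul_add]
  map_smul' c f := by
    ext R
    simp only [ContinuousMap.coe_mk, ContinuousMap.smul_apply, Finset.smul_sum,
      RingHom.id_apply]
    refine Finset.sum_congr rfl fun Q _ => ?_
    rw [ContinuousMap.coe_smul, IndepSets.extend_smul, smul_eq_mul, mul_left_comm]

open Classical in
theorem powersetTransform_apply (hG : IsTopologicalPackingGraph G)
    (hs : ∀ S : Finset V, G.IsIndepSet (S : Set V) → S.card ≤ s) (w : ℕ → ℝ)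
    (f : C(IndepSets G s, ℝ)) (R : IndepSets G t) :
    powersetTransform hG hs t w f R
      = ∑ Q ∈ R.verts.powerset, w (R.verts \ Q).card * IndepSets.extend f Q := rfl

-- Subsets of independent sets are independent, so the extension by zero never takes its default
-- value on them.
omit [TopologicalSpace V] in
theorem IndepSets.extend_of_subset {u : ℕ}
    (ht : ∀ S : Finset V, G.IsIndepSet (S : Set V) → S.card ≤ t)
    (f : IndepSets G t → ℝ) (R : IndepSets G u) {Q : Finset V} (hQ : Q ⊆ R.verts) :
    ∃ S : IndepSets G t, S.verts = Q ∧ IndepSets.extend f Q = f S := by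
  have hi : G.IsIndepSet (Q : Set V) := R.isIndepSet.mono (Finset.coe_subset.2 hQ)
  exact ⟨⟨⟨Q, ht Q hi⟩, hi⟩, rfl, IndepSets.extend_verts f ⟨⟨Q, ht Q hi⟩, hi⟩⟩

open Classical in
theorem extend_powersetTransform (hG : IsTopologicalPackingGraph G)
    (hs : ∀ S : Finset V, G.IsIndepSet (S : Set V) → S.card ≤ s)
    (ht : ∀ S : Finset V, G.IsIndepSet (S : Set V) → S.card ≤ t) (w : ℕ → ℝ)
    (f : C(IndepSets G s, ℝ)) {u : ℕ} (R : IndepSets G u) {Q : Finset V} (hQ : Q ⊆ R.verts) :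
    IndepSets.extend (powersetTransform hG hs t w f) Q
      = ∑ P ∈ Q.powerset, w (Q \ P).card * IndepSets.extend f P := by
  obtain ⟨S, rfl, h⟩ := IndepSets.extend_of_subset ht (powersetTransform hG hs t w f) R hQ
  rw [h, powersetTransform_apply]

/-- The zeta transform inverts the Möbius transform. -/
theorem powersetTransform_one_neg_one_pow (hG : IsTopologicalPackingGraph G)
    (hs : ∀ S : Finset V, G.IsIndepSet (S : Set V) → S.card ≤ s)
    (ht : ∀ S : Finset V, G.IsIndepSet (S : Set V) → S.card ≤ t) (f : C(IndepSets G s, ℝ)) :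
    powersetTransform hG ht s (fun _ => 1) (powersetTransform hG hs t (fun n => (-1) ^ n) f)
      = f := by
  classical
  ext R
  rw [powersetTransform_apply, ← IndepSets.extend_verts f R,
    ← Finset.sum_powerset_sum_powerset_neg_one_pow (IndepSets.extend f)]
  refine Finset.sum_congr rfl fun Q hQ => ?_
  rw [one_mul, extend_powersetTransform hG hs ht _ f R (Finset.mem_powerset.1 hQ)]

/-- The Möbius transform inverts the zeta transform. -/
theorem powersetTransform_neg_one_pow_one (hG : IsTopologicalPackingGraph G)
    (hs : ∀ S : Finset V, G.IsIndepSet (S : Set V) → S.card ≤ s)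
    (ht : ∀ S : Finset V, G.IsIndepSet (S : Set V) → S.card ≤ t) (f : C(IndepSets G s, ℝ)) :
    powersetTransform hG ht s (fun n => (-1) ^ n) (powersetTransform hG hs t (fun _ => 1) f)
      = f := by
  classical
  ext R
  rw [powersetTransform_apply, ← IndepSets.extend_verts f R,
    ← Finset.sum_powerset_neg_one_pow_sum_powerset (IndepSets.extend f)]
  refine Finset.sum_congr rfl fun Q hQ => ?_
  rw [extend_powersetTransform hG hs ht _ f R (Finset.mem_powerset.1 hQ)]
  simp

/-- Integration against `χ_R` is the zeta transform at `R`. -/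
theorem integral_chi (hG : IsTopologicalPackingGraph G)
    (hs : ∀ S : Finset V, G.IsIndepSet (S : Set V) → S.card ≤ s)
    (f : C(IndepSets G s, ℝ)) (R : IndepSets G t) :
    ∫ Q, f Q ∂(chi G s R.verts) = powersetTransform hG hs t (fun _ => 1) f R := by
  classical
  have := hG.t2
  let e : {Q : IndepSets G s // Q.verts ⊆ R.verts} ≃ R.verts.powerset :=
    Equiv.ofBijective (fun Q => ⟨Q.1.verts, Finset.mem_powerset.2 Q.2⟩) <| by
      refine ⟨fun Q Q' h => ?_, fun Q => ?_⟩
      · have h' : Q.1.verts = Q'.1.verts :=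
          congrArg (Subtype.val : R.verts.powerset → Finset V) h
        exact Subtype.ext (IndepSets.verts_injective h')
      · obtain ⟨S, hS, -⟩ := IndepSets.extend_of_subset hs f R (Finset.mem_powerset.1 Q.2)
        exact ⟨⟨S, hS ▸ Finset.mem_powerset.1 Q.2⟩, Subtype.ext hS⟩
  have : Fintype {Q : IndepSets G s // Q.verts ⊆ R.verts} := Fintype.ofEquiv _ e.symm
  rw [chi, Measure.sum_fintype, integral_finsetSum_measure
    (fun Q _ => integrable_dirac (by simp)), powersetTransform_apply,
    ← Finset.sum_coe_sort R.verts.powerset, ← e.sum_comp]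
  refine Finset.sum_congr rfl fun Q _ => ?_
  rw [integral_dirac, one_mul]
  exact (IndepSets.extend_verts f Q.1).symm

theorem isPosDefKernel_mul {X : Type*} [TopologicalSpace X] (h : C(X, ℝ)) :
    IsPosDefKernel ((h.comp ContinuousMap.fst) * (h.comp ContinuousMap.snd) : C(X × X, ℝ)) := by
  refine ⟨fun x y => mul_comm _ _, fun m x => ?_⟩
  have := Matrix.posSemidef_vecMulVec_self_star (fun i => h (x i))
  simpa [Matrix.vecMulVec] using this

/-- If `h` is the Möbius transform of `g`, then `A_t (h ⊗ h)` is the Möbius transform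
of `g ^ 2`. -/
theorem opA_mul_powersetTransform (hG : IsTopologicalPackingGraph G)
    (ht : ∀ S : Finset V, G.IsIndepSet (S : Set V) → S.card ≤ t) (g : C(IndepSets G t, ℝ))
    (S : IndepSets G (2 * t)) :
    let h := powersetTransform hG ht t (fun n => (-1) ^ n) g
    opA G t ((h.comp ContinuousMap.fst) * (h.comp ContinuousMap.snd)) S
      = powersetTransform hG ht (2 * t) (fun n => (-1) ^ n) (g ^ 2) S := by
  classical
  intro h
  rw [opA, finsum_mem_eq_finite_toFinset_sum _ (finite_unionPairs G t S.verts),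
    powersetTransform_apply]
  have hsq : ∀ Q ∈ S.verts.powerset,
      (-1 : ℝ) ^ (S.verts \ Q).card * IndepSets.extend (g ^ 2 : C(IndepSets G t, ℝ)) Q
        = (-1) ^ (S.verts \ Q).card * (∑ J ∈ Q.powerset, IndepSets.extend h J) ^ 2 := by
    intro Q hQ
    rw [Finset.mem_powerset] at hQ
    obtain ⟨R, rfl, hR⟩ := IndepSets.extend_of_subset ht (g ^ 2 : C(IndepSets G t, ℝ)) S hQ
    rw [hR]
    -- The zeta transform of `h` recovers `g`, so the inner sum at `R` is `g R`.
    have h1 := congrArg (fun f : C(IndepSets G t, ℝ) => f R)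
      (powersetTransform_one_neg_one_pow hG ht ht g)
    simp only [powersetTransform_apply (t := t) hG ht (fun _ => 1), one_mul] at h1
    rw [h1, ContinuousMap.pow_apply]
  rw [Finset.sum_congr rfl hsq, ← Finset.sum_union_eq_mul]
  refine Finset.sum_bij (fun p _ => (p.1.verts, p.2.verts)) ?_ ?_ ?_ ?_
  · intro p hp
    rw [Set.Finite.mem_toFinset] at hp
    have hp' : p.1.verts ∪ p.2.verts = S.verts := hp
    simp only [Finset.mem_filter, Finset.mem_product, Finset.mem_powerset, ← hp']
    exact ⟨⟨Finset.subset_union_left, Finset.subset_union_right⟩, trivial⟩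
  · intro p _ q _ hpq
    exact (IndepSets.verts_injective.prodMap IndepSets.verts_injective) hpq
  · rintro ⟨J, J'⟩ hp
    simp only [Finset.mem_filter, Finset.mem_product, Finset.mem_powerset] at hp
    obtain ⟨A, rfl, -⟩ := IndepSets.extend_of_subset ht g S hp.1.1
    obtain ⟨B, rfl, -⟩ := IndepSets.extend_of_subset ht g S hp.1.2
    exact ⟨(A, B), (Set.Finite.mem_toFinset _).2 hp.2, rfl⟩
  · intro p _
    simp

/-- A nonnegative `f` is the square of the continuous function `√f`, so its Möbius transform is
`A_t` of a rank-one positive definite kernel. -/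
theorem IsFeasible.integral_powersetTransform_nonneg [CompactSpace V]
    (hG : IsTopologicalPackingGraph G)
    (ht : ∀ S : Finset V, G.IsIndepSet (S : Set V) → S.card ≤ t)
    {lam : Measure (IndepSets G (2 * t))} (hlam : IsFeasible G t lam)
    (f : C(IndepSets G t, ℝ)) (hf : 0 ≤ f) :
    0 ≤ ∫ S, powersetTransform hG ht (2 * t) (fun n => (-1) ^ n) f S ∂lam := by
  let g : C(IndepSets G t, ℝ) := ⟨fun S => Real.sqrt (f S), f.continuous.sqrt⟩
  have hg : g ^ 2 = f := by
    ext S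
    exact Real.sq_sqrt (hf S)
  have h := hlam.posDef _ (isPosDefKernel_mul (powersetTransform hG ht t (fun n => (-1) ^ n) g))
  rw [adjointA] at h
  simpa only [opA_mul_powersetTransform hG ht g, hg] using h

/-- The constant 1 is the zeta transform of the indicator of `∅`. This converts the normalization of
λ into total mass one for σ. -/
theorem powersetTransform_neg_one_pow_const_one (hG : IsTopologicalPackingGraph G)
    (hs : ∀ S : Finset V, G.IsIndepSet (S : Set V) → S.card ≤ s) (R : IndepSets G t) :
    powersetTransform hG hs t (fun n => (-1) ^ n) 1 R
      = Set.indicator {IndepSets.empty G t} (fun _ => (1 : ℝ)) R := by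
  classical
  have h0 : (R.verts = ∅) ↔ R = IndepSets.empty G t :=
    ⟨fun h => IndepSets.verts_injective h, fun h => by rw [h]; rfl⟩
  have h1 : Set.indicator {IndepSets.empty G t} (fun _ => (1 : ℝ)) R
      = if R.verts = ∅ then 1 else 0 := by
    simp only [Set.indicator_apply, Set.mem_singleton_iff, h0]
  rw [powersetTransform_apply, h1,
    ← Finset.sum_powerset_neg_one_pow_sum_powerset
      (fun S : Finset V => if S = ∅ then (1 : ℝ) else 0)]
  refine Finset.sum_congr rfl fun Q hQ => ?_
  obtain ⟨S, rfl, hS⟩ := IndepSets.extend_of_subset hs (1 : C(IndepSets G s, ℝ)) R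
    (Finset.mem_powerset.1 hQ)
  rw [hS]
  simp

end PackingGraph

end

/-! ### Existence and uniqueness of σ -/

theorem mainTheorem4 {V : Type*} [TopologicalSpace V] [CompactSpace V] (G : SimpleGraph V)
    (hG : PackingGraph.IsTopologicalPackingGraph G)
    (lam : MeasureTheory.Measure (PackingGraph.IndepSets G (2 * G.indepNum)))
    (hlam : PackingGraph.IsFeasible G G.indepNum lam) :
    ∃! σ : MeasureTheory.Measure (PackingGraph.IndepSets G G.indepNum),
      PackingGraph.IsRadon σ ∧ MeasureTheory.IsProbabilityMeasure σ ∧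
        PackingGraph.IsWeakIntegral lam
          (fun R => PackingGraph.chi G (2 * G.indepNum) R.verts) σ := by
  have := hG.t2
  have hc (t : ℕ) : CompactSpace (PackingGraph.IndepSets G t) := hG.compactSpace_indepSets
  have := hlam.isRadon.1
  have hs : ∀ S : Finset V, G.IsIndepSet (S : Set V) → S.card ≤ G.indepNum :=
    fun S hS => hG.card_le_indepNum hS
  have ht : ∀ S : Finset V, G.IsIndepSet (S : Set V) → S.card ≤ 2 * G.indepNum :=
    fun S hS => (hs S hS).trans (by omega)
  let M := PackingGraph.powersetTransform hG hs (2 * G.indepNum) (fun n => (-1) ^ n)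
  let Λ : C(PackingGraph.IndepSets G G.indepNum, ℝ) →ₗ[ℝ] ℝ :=
  { toFun f := ∫ S, M f S ∂lam
    map_add' f g := by
      simp only [map_add, ContinuousMap.add_apply]
      exact integral_add (M f).integrable_of_isFiniteMeasure (M g).integrable_of_isFiniteMeasure
    map_smul' c f := by
      simp only [map_smul, ContinuousMap.smul_apply]
      exact integral_smul c _ }
  obtain ⟨σ, hσr, hσf, hσ⟩ := exists_regular_integral_eq Λ
    (hlam.integral_powersetTransform_nonneg hG hs)
  -- A finite regular measure is inner regular on all Borel sets, so σ is Radon.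
  refine ⟨σ, ⟨⟨inferInstance, inferInstance⟩, ?_, fun f => ?_⟩, ?_⟩
  · have h1 : ∫ _, (1 : ℝ) ∂σ = ∫ S, M 1 S ∂lam := hσ 1
    have h2 : ∫ S, M 1 S ∂lam = 1 := by
      simp only [M, PackingGraph.powersetTransform_neg_one_pow_const_one]
      rw [integral_indicator_const _ (measurableSet_singleton _)]
      simp [Measure.real, hlam.normalized]
    rw [h2] at h1
    refine ⟨?_⟩
    rw [integral_const, smul_eq_mul, mul_one, measureReal_def] at h1
    rw [← ENNReal.ofReal_toReal (measure_ne_top σ Set.univ), h1, ENNReal.ofReal_one]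
  · simp only [PackingGraph.integral_chi hG ht]
    refine ⟨ContinuousMap.integrable_of_isFiniteMeasure _, ?_⟩
    rw [hσ]
    simp only [Λ, M, LinearMap.coe_mk, AddHom.coe_mk]
    rw [PackingGraph.powersetTransform_neg_one_pow_one hG ht hs f]
  · rintro τ ⟨hτr, hτp, hτ⟩
    have := hτr.2
    refine ext_of_integral_eq_of_innerRegular fun f => ?_
    -- Testing the weak integral on `M f` gives `∫ f dτ = ∫ M f dλ`, since the zeta transform undoes
    -- `M`.
    have h := (hτ (M f)).2
    simp only [PackingGraph.integral_chi hG ht, M,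
      PackingGraph.powersetTransform_one_neg_one_pow hG hs ht f] at h
    rw [hσ, ← h]
    rfl
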